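/- Let $X$ be a (real or complex) Banach space with the approximation property (AP), i.e. for every compact set $K\subseteq X$ and every $\varepsilon>0$ there is a finite rank bounded linear operator $S$ on $X$ with $\|Sx-x\|\le\varepsilon$ for all $x\in K$. Let $Y$ be a closed linear subspace of $X$. The following are equivalent. 1. The pair $(X,Y)$ has the AP: there is a net of finite rank bounded linear operators on $X$, all of which leave $Y$ invariant, that converges to the identity operator uniformly on compact subsets of $X$. 2. For every nuclear operator $T$ on $X$ for which $TX\subseteq Y$ and $TY=\{0\}$ we have $\operatorname{tr}(T)=0$. Here a bounded linear operator $T$ on $X$ is nuclear if there are $x_n^*\in X^*$ and $x_n\in X$ with $\sum_{n}\|x_n^*\|\,\|x_n\|<\infty$ and $Tx=\sum_n x_n^*(x)\,x_n$ for all $x\in X$; its trace is $\operatorname{tr}(T)=\sum_n x_n^*(x_n)$, which does not depend on the choice of the representation since $X$ has the AP. -/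

import Mathlib

universe u v w

/-- A bounded linear operator has finite rank. -/
def IsFiniteRank {𝕜 : Type u} [RCLike 𝕜] {X : Type v} [NormedAddCommGroup X] [NormedSpace 𝕜 X]
    (S : X →L[𝕜] X) : Prop :=
  FiniteDimensional 𝕜 (LinearMap.range (S : X →ₗ[𝕜] X))

/-- The approximation property of a normed space: the identity can be approximated, uniformly on
any compact set, by bounded linear operators of finite rank. -/
def HasAP (𝕜 : Type u) [RCLike 𝕜] (X : Type v) [NormedAddCommGroup X] [NormedSpace 𝕜 X] : Prop :=
  ∀ K : Set X, IsCompact K → ∀ ε : ℝ, 0 < ε →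
    ∃ S : X →L[𝕜] X, IsFiniteRank S ∧ ∀ x ∈ K, ‖S x - x‖ ≤ ε

/-- The approximation property of a pair `(X, Y)`: there is a net of finite rank bounded linear
operators on `X`, all of which leave `Y` invariant, that converges to the identity uniformly on
compact subsets of `X`. -/
def HasPairAP {𝕜 : Type u} [RCLike 𝕜] {X : Type v} [NormedAddCommGroup X] [NormedSpace 𝕜 X]
    (Y : Submodule 𝕜 X) : Prop :=
  ∃ (ι : Type v) (_ : Nonempty ι) (_ : Preorder ι) (_ : IsDirectedOrder ι) (S : ι → X →L[𝕜] X),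
    (∀ i, IsFiniteRank (S i) ∧ ∀ y ∈ Y, S i y ∈ Y) ∧
    ∀ K : Set X, IsCompact K →
      TendstoUniformlyOn (fun i x => S i x) (fun x => x) Filter.atTop K

/-- `T = ∑ₙ fₙ ⊗ xₙ` is a nuclear representation of the operator `T`. -/
def IsNuclearRepr {𝕜 : Type u} [RCLike 𝕜] {X : Type v} [NormedAddCommGroup X] [NormedSpace 𝕜 X]
    {Z : Type w} [NormedAddCommGroup Z] [NormedSpace 𝕜 Z]
    (T : X →L[𝕜] Z) (f : ℕ → StrongDual 𝕜 X) (x : ℕ → Z) : Prop :=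
  (Summable fun n => ‖f n‖ * ‖x n‖) ∧ ∀ z : X, HasSum (fun n => f n z • x n) (T z)

/-- Nuclear operators. -/
def IsNuclear {𝕜 : Type u} [RCLike 𝕜] {X : Type v} [NormedAddCommGroup X] [NormedSpace 𝕜 X]
    {Z : Type w} [NormedAddCommGroup Z] [NormedSpace 𝕜 Z] (T : X →L[𝕜] Z) : Prop :=
  ∃ (f : ℕ → StrongDual 𝕜 X) (x : ℕ → Z), IsNuclearRepr T f x

open Classical in
/-- The trace `∑ₙ fₙ(xₙ)` of a nuclear operator `T = ∑ₙ fₙ ⊗ xₙ` on `X`. If `X` has the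
approximation property, then it does not depend on the nuclear representation of `T`;
see `IsNuclearRepr.hasSum_nuclearTrace` below. -/
noncomputable def nuclearTrace {𝕜 : Type u} [RCLike 𝕜] {X : Type v} [NormedAddCommGroup X]
    [NormedSpace 𝕜 X] (T : X →L[𝕜] X) : 𝕜 :=
  if h : IsNuclear T then ∑' n, h.choose n (h.choose_spec.choose n) else 0

/-- A nuclear representation can be rescaled so that the functionals are absolutely summable and
the vectors tend to zero. -/
theorem IsNuclearRepr.exists_rescale {𝕜 : Type u} [RCLike 𝕜] {X : Type v} [NormedAddCommGroup X]
    [NormedSpace 𝕜 X] {f : ℕ → StrongDual 𝕜 X} {x : ℕ → X}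
    (h : Summable fun n => ‖f n‖ * ‖x n‖) :
    ∃ (g : ℕ → StrongDual 𝕜 X) (y : ℕ → X), (Summable fun n => ‖g n‖) ∧
      Filter.Tendsto y Filter.atTop (nhds 0) ∧ ∀ n (S : X →L[𝕜] X), f n (S (x n)) = g n (S (y n)) := by
  set a : ℕ → ℝ := fun n => ‖f n‖ * ‖x n‖ with ha
  have ha0 : ∀ n, 0 ≤ a n := fun n => by positivity
  set r : ℕ → ℝ := fun n => ∑' k, a (k + n) with hr
  have hr0 : ∀ n, 0 ≤ r n := fun n => tsum_nonneg fun k => ha0 _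
  have hstep : ∀ n, r n = a n + r (n + 1) := by
    intro n
    have := ((summable_nat_add_iff n).2 h).tsum_eq_zero_add
    simp only [hr]
    rw [this]
    simp only [zero_add]
    congr 1
    exact tsum_congr fun k => by rw [show k + 1 + n = k + (n + 1) by ring]
  have hrt : Filter.Tendsto r Filter.atTop (nhds 0) := tendsto_sum_nat_add a
  set s : ℕ → ℝ := fun n => Real.sqrt (r n) with hs
  have hs0 : ∀ n, 0 ≤ s n := fun n => Real.sqrt_nonneg _
  have hss : ∀ n, s n * s n = r n := fun n => Real.mul_self_sqrt (hr0 n)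
  have hst : Filter.Tendsto s Filter.atTop (nhds 0) := by
    have := (Real.continuous_sqrt.tendsto 0).comp hrt
    rw [Real.sqrt_zero] at this
    exact this
  have hmono : ∀ n, s (n + 1) ≤ s n := fun n => Real.sqrt_le_sqrt (by linarith [hstep n, ha0 n])
  set c : ℕ → ℝ := fun n => s n / ‖x n‖ with hc
  have hc0 : ∀ n, 0 ≤ c n := fun n => div_nonneg (hs0 n) (norm_nonneg _)
  refine ⟨fun n => ((c n)⁻¹ : 𝕜) • f n, fun n => (c n : 𝕜) • x n, ?_, ?_, ?_⟩
  · refine summable_of_sum_range_le (c := 2 * s 0) (fun n => norm_nonneg _) fun n => ?_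
    have key : ∀ n, ‖((c n)⁻¹ : 𝕜) • f n‖ ≤ 2 * (s n - s (n + 1)) := by
      intro n
      rw [norm_smul, norm_inv, RCLike.norm_ofReal, abs_of_nonneg (hc0 n)]
      have e : (c n)⁻¹ * ‖f n‖ = a n / s n := by simp only [hc, ha, inv_div]; ring
      rw [e]
      rcases (hs0 n).eq_or_lt with h0 | hpos
      · rw [← h0, div_zero]
        linarith [hmono n]
      · rw [div_le_iff₀ hpos]
        nlinarith [hstep n, hss n, hss (n + 1), hmono n, hs0 (n + 1)]
    calc ∑ i ∈ Finset.range n, ‖((c i)⁻¹ : 𝕜) • f i‖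
        ≤ ∑ i ∈ Finset.range n, 2 * (s i - s (i + 1)) := Finset.sum_le_sum fun i _ => key i
      _ = 2 * (s 0 - s n) := by rw [← Finset.mul_sum, Finset.sum_range_sub']
      _ ≤ 2 * s 0 := by linarith [hs0 n]
  · refine squeeze_zero_norm (fun n => ?_) hst
    rw [norm_smul, RCLike.norm_ofReal, abs_of_nonneg (hc0 n)]
    rcases eq_or_ne ‖x n‖ 0 with h0 | h0
    · rw [h0, mul_zero]
      exact hs0 n
    · exact (div_mul_cancel₀ _ h0).le
  · intro n S
    by_cases hcn : c n = 0
    · have h0 : f n = 0 ∨ x n = 0 := by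
        rcases div_eq_zero_iff.1 hcn with h1 | h1
        · have h2 := hss n
          rw [h1] at h2
          have h3 : a n = 0 := by linarith [hstep n, ha0 n, hr0 (n + 1)]
          rcases mul_eq_zero.1 h3 with h4 | h4
          · exact Or.inl (norm_eq_zero.1 h4)
          · exact Or.inr (norm_eq_zero.1 h4)
        · exact Or.inr (norm_eq_zero.1 h1)
      rcases h0 with h0 | h0 <;> simp [h0]
    · have : (c n : 𝕜) ≠ 0 := by exact_mod_cast hcn
      simp [this]

/-- For a nuclear `T = ∑ₙ fₙ ⊗ xₙ` and `S` of finite rank, `∑ₙ fₙ(S xₙ)` depends only on `T`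
and `S`. -/
theorem IsFiniteRank.exists_hasSum {𝕜 : Type u} [RCLike 𝕜] {X : Type v} [NormedAddCommGroup X]
    [NormedSpace 𝕜 X] {S : X →L[𝕜] X} (hS : IsFiniteRank S) (T : X →L[𝕜] X) :
    ∃ t : 𝕜, ∀ (f : ℕ → StrongDual 𝕜 X) (x : ℕ → X), IsNuclearRepr T f x →
      HasSum (fun n => f n (S (x n))) t := by
  have : FiniteDimensional 𝕜 (LinearMap.range (S : X →ₗ[𝕜] X)) := hS
  let b := Module.finBasis 𝕜 (LinearMap.range (S : X →ₗ[𝕜] X))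
  let S' : X →L[𝕜] LinearMap.range (S : X →ₗ[𝕜] X) :=
    S.codRestrict _ fun z => LinearMap.mem_range_self (S : X →ₗ[𝕜] X) z
  let φ := fun i => (LinearMap.toContinuousLinearMap (b.coord i)).comp S'
  have hdec : ∀ z, S z = ∑ i, φ i z • (b i : X) := by
    intro z
    have := congrArg Subtype.val (b.sum_repr (S' z))
    simp only [Submodule.coe_sum, Submodule.coe_smul] at this
    exact this.symm
  refine ⟨∑ i, φ i (T (b i)), fun f x h => ?_⟩
  have h1 : HasSum (fun n => ∑ i, φ i (f n (b i) • x n)) (∑ i, φ i (T (b i))) :=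
    hasSum_sum fun i _ => (φ i).hasSum (h.2 (b i))
  convert h1 using 2 with n
  rw [hdec, map_sum]
  exact Finset.sum_congr rfl fun i _ => by simp [mul_comm]

/-- If `X` has the approximation property, then the trace of a nuclear operator on `X` can be
computed from any of its nuclear representations. -/
theorem IsNuclearRepr.hasSum_nuclearTrace {𝕜 : Type u} [RCLike 𝕜] {X : Type v}
    [NormedAddCommGroup X] [NormedSpace 𝕜 X] (hX : HasAP 𝕜 X) {T : X →L[𝕜] X}
    {f : ℕ → StrongDual 𝕜 X} {x : ℕ → X} (h : IsNuclearRepr T f x) :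
    HasSum (fun n => f n (x n)) (nuclearTrace T) := by
  have hsum : ∀ {f : ℕ → StrongDual 𝕜 X} {x : ℕ → X}, IsNuclearRepr T f x →
      Summable fun n => f n (x n) := fun h =>
    Summable.of_norm_bounded h.1 fun n => ContinuousLinearMap.le_opNorm _ _
  have happ : ∀ {f : ℕ → StrongDual 𝕜 X} {x : ℕ → X}, IsNuclearRepr T f x →
      ∃ (C : ℝ) (K : Set X), 0 ≤ C ∧ IsCompact K ∧ ∀ (S : X →L[𝕜] X) (ε : ℝ) (t : 𝕜),
        (∀ z ∈ K, ‖S z - z‖ ≤ ε) → HasSum (fun n => f n (S (x n))) t →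
        ‖t - ∑' n, f n (x n)‖ ≤ ε * C := by
    intro f x h
    obtain ⟨g, y, hg, hy, hfg⟩ := IsNuclearRepr.exists_rescale h.1
    refine ⟨∑' n, ‖g n‖, insert 0 (Set.range y), tsum_nonneg fun n => norm_nonneg _,
      hy.isCompact_insert_range, fun S ε t hS ht => ?_⟩
    have h1 := ht.sub (hsum h).hasSum
    rw [← h1.tsum_eq, ← tsum_mul_left]
    refine tsum_of_norm_bounded (hg.mul_left ε).hasSum fun n => ?_
    have e1 := hfg n S
    have e2 := hfg n (ContinuousLinearMap.id 𝕜 X)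
    simp only [ContinuousLinearMap.id_apply] at e2
    rw [e1, e2, ← map_sub]
    calc ‖g n (S (y n) - y n)‖ ≤ ‖g n‖ * ‖S (y n) - y n‖ := ContinuousLinearMap.le_opNorm _ _
      _ ≤ ‖g n‖ * ε := by
        gcongr
        exact hS _ (Set.mem_insert_of_mem _ (Set.mem_range_self n))
      _ = ε * ‖g n‖ := mul_comm _ _
  have huniq : ∀ {f g : ℕ → StrongDual 𝕜 X} {x y : ℕ → X}, IsNuclearRepr T f x →
      IsNuclearRepr T g y → ∑' n, f n (x n) = ∑' n, g n (y n) := by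
    intro f g x y hf hg
    obtain ⟨C, K, hC, hK, h1⟩ := happ hf
    obtain ⟨D, L, hD, hL, h2⟩ := happ hg
    refine eq_of_forall_dist_le fun δ hδ => ?_
    obtain ⟨S, hS, hSKL⟩ := hX (K ∪ L) (hK.union hL) (δ / (C + D + 1)) (by positivity)
    obtain ⟨t, ht⟩ := hS.exists_hasSum T
    have b1 := h1 S _ t (fun z hz => hSKL z (Or.inl hz)) (ht f x hf)
    have b2 := h2 S _ t (fun z hz => hSKL z (Or.inr hz)) (ht g y hg)
    rw [← dist_eq_norm] at b1 b2
    calc dist (∑' n, f n (x n)) (∑' n, g n (y n)) ≤ _ := dist_triangle_left _ _ t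
      _ ≤ δ / (C + D + 1) * C + δ / (C + D + 1) * D := add_le_add b1 b2
      _ ≤ δ / (C + D + 1) * (C + D + 1) := by
        have : 0 ≤ δ / (C + D + 1) := by positivity
        nlinarith
      _ = δ := by field_simp
  have hT : IsNuclear T := ⟨f, x, h⟩
  rw [nuclearTrace, dif_pos hT, huniq hT.choose_spec.choose_spec h]
  exact (hsum h).hasSum

/-! If `S` has finite rank and preserves `Y`, while `T` maps into `Y` and kills `Y`, then `T S T =
0`. Thus `S T` is nilpotent on the range of `S` and has trace zero (`IsFiniteRank.hasSum_zero`);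
letting `S` tend to the identity on a compact set adapted to `T` gives `tr T = 0`.

The converse is a Hahn–Banach argument in `C₀(ℕ, X)`. By `IsCompact.exists_null_sequence` it
suffices to approximate the identity along a null sequence `e`. If this fails, a functional `F`,
given by summable `fₙ` in the dual of `X`, kills all `(S eₙ)` with `S` admissible but not `e`. Then
`T = ∑ fₙ ⊗ eₙ` is nuclear with trace `F e ≠ 0`, and testing `F` on rank-one `S` shows `T X ⊆ Y` and
`T Y = 0`, a contradiction. The AP of `X` serves only to make the trace independent of the
representation. -/

open Filter Topology ZeroAtInfty

/-! ### Separation from a closed subspace -/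

section HahnBanach

variable {𝕜 : Type u} [RCLike 𝕜] {E : Type v} [NormedAddCommGroup E] [NormedSpace 𝕜 E]

/-- A point outside a closed subspace is separated from it by a continuous functional vanishing on
the subspace. -/
theorem Submodule.exists_strongDual_of_notMem {M : Submodule 𝕜 E} (hM : IsClosed (M : Set E))
    {e : E} (he : e ∉ M) : ∃ F : StrongDual 𝕜 E, (∀ z ∈ M, F z = 0) ∧ F e ≠ 0 := by
  have : IsClosed (M : Set E) := hM
  have hne : ‖M.mkQL e‖ ≠ 0 := by
    rw [norm_ne_zero_iff, Submodule.mkQL_apply]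
    simpa using he
  obtain ⟨g, -, hg⟩ := exists_dual_vector 𝕜 (M.mkQL e) hne
  refine ⟨g.comp M.mkQL, fun z hz => ?_, ?_⟩
  · have : M.mkQL z = 0 := by
      rw [Submodule.mkQL_apply]
      simpa using hz
    rw [ContinuousLinearMap.comp_apply, this, map_zero]
  · rw [ContinuousLinearMap.comp_apply, hg]
    exact_mod_cast hne

end HahnBanach

/-! ### The space of null sequences and its dual -/

section NullSequences

variable {𝕜 : Type u} [RCLike 𝕜] {X : Type v} [NormedAddCommGroup X] [NormedSpace 𝕜 X]

/-- A null sequence, as an element of `C₀(ℕ, X)`. -/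
def nullSeq (e : ℕ → X) (he : Tendsto e atTop (𝓝 0)) : C₀(ℕ, X) where
  toFun := e
  continuous_toFun := continuous_of_discreteTopology
  zero_at_infty' := by rwa [cocompact_eq_cofinite, Nat.cofinite_eq_atTop]

@[simp]
theorem nullSeq_apply (e : ℕ → X) (he : Tendsto e atTop (𝓝 0)) (n : ℕ) : nullSeq e he n = e n :=
  rfl

theorem ZeroAtInftyContinuousMap.tendsto_atTop (y : C₀(ℕ, X)) : Tendsto y atTop (𝓝 0) := by
  have := y.zero_at_infty'
  rwa [cocompact_eq_cofinite, Nat.cofinite_eq_atTop] at this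

theorem ZeroAtInftyContinuousMap.norm_apply_le (y : C₀(ℕ, X)) (n : ℕ) : ‖y n‖ ≤ ‖y‖ :=
  y.toBCF.norm_coe_le_norm n

theorem ZeroAtInftyContinuousMap.norm_le_of_forall {y : C₀(ℕ, X)} {C : ℝ} (hC : 0 ≤ C)
    (h : ∀ n, ‖y n‖ ≤ C) : ‖y‖ ≤ C :=
  (BoundedContinuousFunction.norm_le (f := y.toBCF) hC).2 h

variable (𝕜 X) in
/-- The `n`-th coordinate embedding of `X` into `C₀(ℕ, X)`. -/
noncomputable def nullSeqSingle (n : ℕ) : X →L[𝕜] C₀(ℕ, X) :=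
  LinearMap.mkContinuous
    { toFun := fun z => nullSeq (Pi.single n z) <| tendsto_const_nhds.congr' <| by
        filter_upwards [eventually_gt_atTop n] with m hm
        rw [Pi.single_eq_of_ne hm.ne']
      map_add' := fun z w => by
        ext m
        simp [Pi.single_add]
      map_smul' := fun c z => by
        ext m
        simp [Pi.single_smul] } 1 fun z => by
    rw [one_mul]
    refine ZeroAtInftyContinuousMap.norm_le_of_forall (norm_nonneg _) fun m => ?_
    by_cases h : m = n
    · subst h
      simp
    · simp [Pi.single_eq_of_ne h]

theorem nullSeqSingle_apply (n : ℕ) (z : X) (m : ℕ) :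
    nullSeqSingle 𝕜 X n z m = if m = n then z else 0 :=
  Pi.single_apply n z m

theorem sum_nullSeqSingle_apply (s : Finset ℕ) (z : ℕ → X) (m : ℕ) :
    (∑ n ∈ s, nullSeqSingle 𝕜 X n (z n)) m = if m ∈ s then z m else 0 := by
  have : (∑ n ∈ s, nullSeqSingle 𝕜 X n (z n)) m = ∑ n ∈ s, nullSeqSingle 𝕜 X n (z n) m := by
    induction s using Finset.induction_on with
    | empty => simp
    | insert a s ha ih => rw [Finset.sum_insert ha, Finset.sum_insert ha, ← ih]; rfl
  rw [this]
  simp [nullSeqSingle_apply]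

theorem hasSum_nullSeqSingle (y : C₀(ℕ, X)) :
    HasSum (fun n => nullSeqSingle 𝕜 X n (y n)) y := by
  rw [HasSum, SummationFilter.unconditional_filter, Metric.tendsto_atTop]
  intro ε hε
  obtain ⟨N, hN⟩ := Metric.tendsto_atTop.1 y.tendsto_atTop (ε / 2) (half_pos hε)
  refine ⟨Finset.range N, fun s hs => lt_of_le_of_lt ?_ (half_lt_self hε)⟩
  rw [dist_eq_norm]
  refine ZeroAtInftyContinuousMap.norm_le_of_forall (half_pos hε).le fun m => ?_
  rw [ZeroAtInftyContinuousMap.sub_apply, sum_nullSeqSingle_apply]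
  split_ifs with hm
  · simpa using (half_pos hε).le
  · have hNm : N ≤ m := by
      by_contra h
      exact hm (hs (Finset.mem_range.2 (not_le.1 h)))
    simpa using (hN m hNm).le

/-- Continuous functionals on `C₀(ℕ, X)` are absolutely summable sequences of functionals
on `X`. -/
theorem exists_summable_of_strongDual_nullSeq (F : StrongDual 𝕜 C₀(ℕ, X)) :
    ∃ f : ℕ → StrongDual 𝕜 X, (Summable fun n => ‖f n‖) ∧
      ∀ y : C₀(ℕ, X), HasSum (fun n => f n (y n)) (F y) := by
  refine ⟨fun n => F.comp (nullSeqSingle 𝕜 X n), ?_, fun y => F.hasSum (hasSum_nullSeqSingle y)⟩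
  -- Vectors norming up to a factor 2, rotated so that the values are real and cannot cancel. Placed
  -- in distinct coordinates they form a sequence of sup norm at most 1.
  have hz : ∀ g : StrongDual 𝕜 X, ∃ (z : X) (r : ℝ), ‖z‖ ≤ 1 ∧ ‖g‖ / 2 ≤ r ∧ g z = (r : 𝕜) := by
    intro g
    rcases (norm_nonneg g).eq_or_lt with h0 | hpos
    · exact ⟨0, 0, by simp, by simp [← h0], by simp⟩
    · obtain ⟨z, hz, hgz⟩ := g.exists_lt_apply_of_lt_opNorm (half_lt_self hpos)
      obtain ⟨c, hc, hcz⟩ := RCLike.exists_norm_eq_mul_self (g z)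
      exact ⟨c • z, ‖g z‖, by rw [norm_smul, hc, one_mul]; exact hz.le, hgz.le,
        by rw [map_smul, smul_eq_mul, hcz]⟩
  choose z r hz1 hr hzr using hz
  refine summable_of_sum_le (c := 2 * ‖F‖) (fun n => norm_nonneg _) fun s => ?_
  set f : ℕ → StrongDual 𝕜 X := fun n => F.comp (nullSeqSingle 𝕜 X n) with hf
  have hsum : ((∑ n ∈ s, r (f n) : ℝ) : 𝕜) = F (∑ n ∈ s, nullSeqSingle 𝕜 X n (z (f n))) := by
    rw [map_sum, RCLike.ofReal_sum]
    exact Finset.sum_congr rfl fun n _ => (hzr (f n)).symm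
  have hle : ‖∑ n ∈ s, nullSeqSingle 𝕜 X n (z (f n))‖ ≤ 1 := by
    refine ZeroAtInftyContinuousMap.norm_le_of_forall zero_le_one fun m => ?_
    rw [sum_nullSeqSingle_apply]
    split_ifs
    · exact hz1 _
    · simp
  have hbd : ∑ n ∈ s, r (f n) ≤ ‖F‖ := by
    calc ∑ n ∈ s, r (f n) ≤ ‖((∑ n ∈ s, r (f n) : ℝ) : 𝕜)‖ := by
          rw [RCLike.norm_ofReal]
          exact le_abs_self _
      _ ≤ ‖F‖ * 1 := by
          rw [hsum]
          exact (F.le_opNorm _).trans (mul_le_mul_of_nonneg_left hle (norm_nonneg F))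
      _ = ‖F‖ := mul_one _
  calc ∑ n ∈ s, ‖f n‖ ≤ ∑ n ∈ s, 2 * r (f n) :=
        Finset.sum_le_sum fun n _ => by linarith [hr (f n)]
    _ ≤ 2 * ‖F‖ := by rw [← Finset.mul_sum]; linarith

end NullSequences

/-! ### Compact sets and null sequences -/

section Compact

theorem tendsto_extend_zero_cofinite {α β E : Type*} [TopologicalSpace E] [Zero E] {g : α → β}
    (hg : Function.Injective g) {v : α → E} (hv : Tendsto v cofinite (𝓝 0)) :
    Tendsto (Function.extend g v 0) cofinite (𝓝 0) := by
  intro U hU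
  refine ((hv hU : {a | v a ∈ U}ᶜ.Finite).image g).subset fun b hb => ?_
  by_cases hbg : ∃ a, g a = b
  · obtain ⟨a, rfl⟩ := hbg
    refine ⟨a, fun ha => hb ?_, rfl⟩
    simpa [hg.extend_apply] using ha
  · refine absurd ?_ hb
    simpa [Function.extend_apply' _ _ _ hbg] using mem_of_mem_nhds hU

/-- A compact set in a Banach space is absorbed by a null sequence: each of its points is a series
`∑ₖ 2⁻ᵏ eₙ₍ₖ₎` in the terms of the sequence. -/
theorem IsCompact.exists_null_sequence (𝕜 : Type u) [RCLike 𝕜] {X : Type v}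
    [NormedAddCommGroup X] [NormedSpace 𝕜 X] [CompleteSpace X] {K : Set X} (hK : IsCompact K) :
    ∃ e : ℕ → X, Tendsto e atTop (𝓝 0) ∧
      ∀ x ∈ K, ∃ n : ℕ → ℕ, HasSum (fun k => ((1 / 2 : 𝕜) ^ k) • e (n k)) x := by
  have hnet : ∀ k : ℕ, ∃ p : X → X, (p '' K).Finite ∧ ∀ x ∈ K, ‖p x - x‖ ≤ (1 / 4 : ℝ) ^ k := by
    intro k
    obtain ⟨t, -, htf, ht⟩ := hK.finite_cover_balls (e := (1 / 4 : ℝ) ^ k) (by positivity)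
    have : ∀ x, ∃ y, x ∈ K → y ∈ t ∧ ‖y - x‖ ≤ (1 / 4 : ℝ) ^ k := by
      intro x
      by_cases hx : x ∈ K
      · obtain ⟨y, hy, hxy⟩ := Set.mem_iUnion₂.1 (ht hx)
        refine ⟨y, fun _ => ⟨hy, ?_⟩⟩
        rw [Metric.mem_ball, dist_comm, dist_eq_norm] at hxy
        exact hxy.le
      · exact ⟨0, fun h => absurd h hx⟩
    choose p hp using this
    exact ⟨p, htf.subset (Set.image_subset_iff.2 fun x hx => (hp x hx).1), fun x hx => (hp x hx).2⟩
  choose q hqf hq using hnet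
  let p : ℕ → X → X := fun k => Nat.casesOn k (fun _ => 0) q
  have hpf : ∀ k, (p k '' K).Finite := by
    intro k
    cases k with
    | zero => exact (Set.finite_singleton 0).subset (Set.image_subset_iff.2 fun x _ => rfl)
    | succ k => exact hqf k
  let d : ℕ → X → X := fun k x => p (k + 1) x - p k x
  have hdf : ∀ k, (d k '' K).Finite := fun k =>
    ((hpf (k + 1)).image2 (fun a b => a - b) (hpf k)).subset <| Set.image_subset_iff.2 fun x hx =>
      ⟨_, ⟨x, hx, rfl⟩, _, ⟨x, hx, rfl⟩, rfl⟩
  have hdn : ∀ k, 1 ≤ k → ∀ x ∈ K, ‖d k x‖ ≤ 5 * (1 / 4 : ℝ) ^ k := by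
    intro k hk x hx
    obtain ⟨j, rfl⟩ := Nat.exists_eq_add_of_le' hk
    calc ‖d (j + 1) x‖ = ‖(q (j + 1) x - x) - (q j x - x)‖ := by
          rw [sub_sub_sub_cancel_right]
      _ ≤ ‖q (j + 1) x - x‖ + ‖q j x - x‖ := norm_sub_le _ _
      _ ≤ (1 / 4 : ℝ) ^ (j + 1) + (1 / 4 : ℝ) ^ j := add_le_add (hq _ x hx) (hq _ x hx)
      _ = 5 * (1 / 4 : ℝ) ^ (j + 1) := by ring
  have hfin : ∀ k, Finite (d k '' K) := fun k => (hdf k).to_subtype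
  have hcount : ∀ k, Countable (d k '' K) := fun k => (hdf k).countable.to_subtype
  -- The differences decay like `4⁻ᵏ`, so they still tend to zero after scaling by `2ᵏ`. Each level
  -- is finite, so any enumeration is a null sequence.
  let v : (Σ k, d k '' K) → X := fun i => (2 : 𝕜) ^ i.1 • (i.2 : X)
  have hfst : Tendsto (Sigma.fst : (Σ k, d k '' K) → ℕ) cofinite atTop := by
    rw [← Nat.cofinite_eq_atTop]
    refine Filter.Tendsto.cofinite_of_finite_preimage_singleton fun k => ?_
    refine ((Set.finite_range (fun z : d k '' K => (⟨k, z⟩ : Σ k, d k '' K))).subset ?_).to_subtype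
    rintro ⟨j, z⟩ rfl
    exact ⟨z, rfl⟩
  have hv : Tendsto v cofinite (𝓝 0) := by
    have hgeo : Tendsto (fun k : ℕ => 5 * (1 / 2 : ℝ) ^ k) atTop (𝓝 0) := by
      simpa using (tendsto_pow_atTop_nhds_zero_of_lt_one (r := (1 / 2 : ℝ)) (by norm_num)
        (by norm_num)).const_mul 5
    refine squeeze_zero_norm' ?_ (hgeo.comp hfst)
    filter_upwards [hfst.eventually (eventually_ge_atTop 1)] with ⟨k, z, x, hx, hz⟩ hk
    have h2 : (2 : ℝ) ^ k * (1 / 4) ^ k = (1 / 2) ^ k := by rw [← mul_pow]; norm_num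
    calc ‖(2 : 𝕜) ^ k • z‖ = 2 ^ k * ‖d k x‖ := by
          rw [norm_smul, norm_pow, RCLike.norm_two, hz]
      _ ≤ 2 ^ k * (5 * (1 / 4 : ℝ) ^ k) := by gcongr; exact hdn k hk x hx
      _ = 5 * (1 / 2 : ℝ) ^ k := by rw [← h2]; ring
  obtain ⟨enc, henc⟩ := exists_injective_nat (Σ k, d k '' K)
  refine ⟨Function.extend enc v 0, ?_, fun x hx =>
    ⟨fun k => enc ⟨k, d k x, x, hx, rfl⟩, ?_⟩⟩
  · rw [← Nat.cofinite_eq_atTop]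
    exact tendsto_extend_zero_cofinite henc hv
  · have hterm : ∀ k, ((1 / 2 : 𝕜) ^ k) • Function.extend enc v 0 (enc ⟨k, d k x, x, hx, rfl⟩)
        = d k x := by
      intro k
      rw [henc.extend_apply, smul_smul, ← mul_pow]
      norm_num
    simp only [hterm]
    have hsum : Summable fun k => d k x := by
      refine Summable.of_norm_bounded_eventually_nat (g := fun k => 5 * (1 / 4 : ℝ) ^ k)
        ((summable_geometric_of_lt_one (by norm_num) (by norm_num)).mul_left 5) ?_
      filter_upwards [eventually_ge_atTop 1] with k hk using hdn k hk x hx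
    rw [hsum.hasSum_iff_tendsto_nat]
    have hp0 : ∀ n, ∑ k ∈ Finset.range n, d k x = p n x := by
      intro n
      rw [Finset.sum_range_sub (fun k => p k x)]
      exact sub_zero _
    simp only [hp0]
    rw [← tendsto_add_atTop_iff_nat 1, tendsto_iff_norm_sub_tendsto_zero]
    exact squeeze_zero (fun _ => norm_nonneg _) (fun k => hq k x hx)
      (tendsto_pow_atTop_nhds_zero_of_lt_one (by norm_num) (by norm_num))

end Compact

/-! ### Nilpotency and the vanishing of the trace -/

section PairAP

variable {𝕜 : Type u} [RCLike 𝕜] {X : Type v} [NormedAddCommGroup X] [NormedSpace 𝕜 X]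

/-- If `S` has finite rank and `S T S T = 0`, then the trace of `S T` vanishes. -/
theorem IsFiniteRank.hasSum_zero {S T : X →L[𝕜] X} (hS : IsFiniteRank S)
    (hST : ∀ z, S (T (S (T z))) = 0) {f : ℕ → StrongDual 𝕜 X} {x : ℕ → X}
    (h : IsNuclearRepr T f x) : HasSum (fun n => f n (S (x n))) 0 := by
  have : FiniteDimensional 𝕜 (LinearMap.range (S : X →ₗ[𝕜] X)) := hS
  let b := Module.finBasis 𝕜 (LinearMap.range (S : X →ₗ[𝕜] X))
  let S' : X →L[𝕜] LinearMap.range (S : X →ₗ[𝕜] X) :=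
    S.codRestrict _ fun z => LinearMap.mem_range_self (S : X →ₗ[𝕜] X) z
  let φ := fun i => (LinearMap.toContinuousLinearMap (b.coord i)).comp S'
  have hdec : ∀ z, S z = ∑ i, φ i z • (b i : X) := by
    intro z
    have := congrArg Subtype.val (b.sum_repr (S' z))
    simp only [Submodule.coe_sum, Submodule.coe_smul] at this
    exact this.symm
  -- `S T` restricted to the range of `S` squares to zero; its trace in the basis `b` is the sum
  -- that the nuclear series evaluates to.
  let R : LinearMap.range (S : X →ₗ[𝕜] X) →ₗ[𝕜] LinearMap.range (S : X →ₗ[𝕜] X) :=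
    (S' : X →ₗ[𝕜] _) ∘ₗ (T : X →ₗ[𝕜] X) ∘ₗ Submodule.subtype _
  have hR : IsNilpotent R := ⟨2, by
    ext z
    rw [pow_two]
    exact hST z⟩
  have htr : ∑ i, φ i (T (b i)) = 0 := by
    have h0 := (LinearMap.isNilpotent_trace_of_isNilpotent hR).eq_zero
    rw [LinearMap.trace_eq_matrix_trace 𝕜 b, Matrix.trace] at h0
    simp only [Matrix.diag_apply, LinearMap.toMatrix_apply] at h0
    exact h0
  have h1 : HasSum (fun n => ∑ i, φ i (f n (b i) • x n)) (∑ i, φ i (T (b i))) :=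
    hasSum_sum fun i _ => (φ i).hasSum (h.2 (b i))
  rw [htr] at h1
  convert h1 using 2 with n
  rw [hdec, map_sum]
  exact Finset.sum_congr rfl fun i _ => by simp [mul_comm]

/-- The trace form of a nuclear operator is continuous for uniform convergence on a suitable
compact set. -/
theorem IsNuclearRepr.exists_compact_norm_sub_le {T : X →L[𝕜] X} {f : ℕ → StrongDual 𝕜 X}
    {x : ℕ → X} (h : IsNuclearRepr T f x) {s : 𝕜} (hs : HasSum (fun n => f n (x n)) s) :
    ∃ (C : ℝ) (K : Set X), 0 ≤ C ∧ IsCompact K ∧ ∀ (S : X →L[𝕜] X) (ε : ℝ) (t : 𝕜),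
      (∀ z ∈ K, ‖S z - z‖ ≤ ε) → HasSum (fun n => f n (S (x n))) t → ‖t - s‖ ≤ ε * C := by
  obtain ⟨g, y, hg, hy, hfg⟩ := IsNuclearRepr.exists_rescale h.1
  refine ⟨∑' n, ‖g n‖, insert 0 (Set.range y), tsum_nonneg fun n => norm_nonneg _,
    hy.isCompact_insert_range, fun S ε t hS ht => ?_⟩
  have h1 := ht.sub hs
  rw [← h1.tsum_eq, ← tsum_mul_left]
  refine tsum_of_norm_bounded (hg.mul_left ε).hasSum fun n => ?_
  have e2 := hfg n (ContinuousLinearMap.id 𝕜 X)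
  simp only [ContinuousLinearMap.id_apply] at e2
  rw [hfg n S, e2, ← map_sub]
  calc ‖g n (S (y n) - y n)‖ ≤ ‖g n‖ * ‖S (y n) - y n‖ := ContinuousLinearMap.le_opNorm _ _
    _ ≤ ‖g n‖ * ε := by
      gcongr
      exact hS _ (Set.mem_insert_of_mem _ (Set.mem_range_self n))
    _ = ε * ‖g n‖ := mul_comm _ _

theorem HasPairAP.nuclearTrace_eq_zero (hX : HasAP 𝕜 X) {Y : Submodule 𝕜 X} (hXY : HasPairAP Y)
    {T : X →L[𝕜] X} (hT : IsNuclear T) (hTY : ∀ x, T x ∈ Y) (hT0 : ∀ y ∈ Y, T y = 0) :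
    nuclearTrace T = 0 := by
  obtain ⟨f, x, h⟩ := hT
  obtain ⟨C, K, hC, hK, hbd⟩ := h.exists_compact_norm_sub_le (h.hasSum_nuclearTrace hX)
  obtain ⟨ι, _, _, _, S, hS, hlim⟩ := hXY
  refine norm_le_zero_iff.1 (le_of_forall_pos_le_add fun δ hδ => ?_)
  obtain ⟨i, hi⟩ := (Metric.tendstoUniformlyOn_iff.1 (hlim K hK) (δ / (C + 1))
    (by positivity)).exists
  -- `S (T z)` stays in `Y`, where `T` vanishes.
  have hz := (hS i).1.hasSum_zero (fun z => by rw [hT0 _ ((hS i).2 _ (hTY z)), map_zero]) h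
  have := hbd (S i) (δ / (C + 1)) 0
    (fun z hz => by rw [← dist_eq_norm, dist_comm]; exact (hi z hz).le) hz
  rw [zero_sub, norm_neg] at this
  calc ‖nuclearTrace T‖ ≤ δ / (C + 1) * C := this
    _ ≤ δ / (C + 1) * (C + 1) := by gcongr; linarith
    _ = 0 + δ := by field_simp; ring

/-! ### Duality and the construction of the approximating net -/

/-- The finite rank operators leaving `Y` invariant. -/
def finiteRankInvariant (Y : Submodule 𝕜 X) : Submodule 𝕜 (X →L[𝕜] X) where
  carrier := {S | IsFiniteRank S ∧ ∀ y ∈ Y, S y ∈ Y}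
  zero_mem' := by
    refine ⟨?_, fun y _ => Y.zero_mem⟩
    rw [IsFiniteRank, ContinuousLinearMap.toLinearMap_zero, LinearMap.range_zero]
    infer_instance
  add_mem' := by
    rintro S R ⟨hS, hSY⟩ ⟨hR, hRY⟩
    refine ⟨?_, fun y hy => Y.add_mem (hSY y hy) (hRY y hy)⟩
    rw [IsFiniteRank] at hS hR ⊢
    exact Submodule.finiteDimensional_of_le
      (LinearMap.range_add_le (S : X →ₗ[𝕜] X) (R : X →ₗ[𝕜] X))
  smul_mem' := by
    rintro c S ⟨hS, hSY⟩
    refine ⟨?_, fun y hy => Y.smul_mem c (hSY y hy)⟩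
    rw [IsFiniteRank] at hS ⊢
    refine Submodule.finiteDimensional_of_le (S₂ := LinearMap.range (S : X →ₗ[𝕜] X)) ?_
    rintro _ ⟨z, rfl⟩
    exact ⟨c • z, map_smul S c z⟩

theorem mem_finiteRankInvariant {Y : Submodule 𝕜 X} {S : X →L[𝕜] X} :
    S ∈ finiteRankInvariant Y ↔ IsFiniteRank S ∧ ∀ y ∈ Y, S y ∈ Y :=
  Iff.rfl

theorem isFiniteRank_smulRight (g : StrongDual 𝕜 X) (z : X) : IsFiniteRank (g.smulRight z) := by
  rw [IsFiniteRank]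
  refine Submodule.finiteDimensional_of_le (S₂ := Submodule.span 𝕜 {z}) ?_
  rintro _ ⟨w, rfl⟩
  exact Submodule.smul_mem _ _ (Submodule.mem_span_singleton_self z)

variable (𝕜) in
/-- Evaluation of operators along a null sequence. -/
noncomputable def evalNullSeq (e : C₀(ℕ, X)) :
    (X →L[𝕜] X) →ₗ[𝕜] C₀(ℕ, X) where
  toFun S := nullSeq (fun n => S (e n)) <| by
    simpa [Function.comp_def] using (S.continuous.tendsto 0).comp e.tendsto_atTop
  map_add' S R := by
    ext n
    simp
  map_smul' c S := by
    ext n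
    simp

@[simp]
theorem evalNullSeq_apply (e : C₀(ℕ, X)) (S : X →L[𝕜] X) (n : ℕ) :
    evalNullSeq 𝕜 e S n = S (e n) :=
  rfl

theorem exists_isNuclearRepr [CompleteSpace X] {f : ℕ → StrongDual 𝕜 X} {x : ℕ → X}
    (h : Summable fun n => ‖f n‖ * ‖x n‖) : ∃ T : X →L[𝕜] X, IsNuclearRepr T f x := by
  have hsum : Summable fun n => (f n).smulRight (x n) :=
    Summable.of_norm_bounded h fun n => (ContinuousLinearMap.norm_smulRight_apply _ _).le
  obtain ⟨T, hT⟩ := hsum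
  refine ⟨T, h, fun z => ?_⟩
  have := (ContinuousLinearMap.apply 𝕜 X z).hasSum hT
  simpa only [Function.comp_def, ContinuousLinearMap.apply_apply,
    ContinuousLinearMap.smulRight_apply] using this

theorem mem_closure_map_evalNullSeq [CompleteSpace X] (hX : HasAP 𝕜 X) {Y : Submodule 𝕜 X}
    (hY : IsClosed (Y : Set X))
    (h : ∀ T : X →L[𝕜] X, IsNuclear T → (∀ x : X, T x ∈ Y) → (∀ y ∈ Y, T y = 0) →
      nuclearTrace T = 0) (e : C₀(ℕ, X)) :
    e ∈ ((finiteRankInvariant Y).map (evalNullSeq 𝕜 e)).topologicalClosure := by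
  by_contra he
  obtain ⟨F, hF, hFe⟩ := Submodule.exists_strongDual_of_notMem
    (Submodule.isClosed_topologicalClosure _) he
  obtain ⟨f, hf, hfF⟩ := exists_summable_of_strongDual_nullSeq F
  have hfe : Summable fun n => ‖f n‖ * ‖e n‖ :=
    Summable.of_nonneg_of_le (fun n => by positivity)
      (fun n => mul_le_mul_of_nonneg_left (e.norm_apply_le n) (norm_nonneg _)) (hf.mul_right ‖e‖)
  obtain ⟨T, hT⟩ := exists_isNuclearRepr hfe
  -- On the rank-one operator `g ⊗ z`, `F` takes the value `∑ g(eₙ) fₙ(z) = g (T z)`.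
  have hrank : ∀ (g : StrongDual 𝕜 X) (z : X), (∀ y ∈ Y, g y • z ∈ Y) → g (T z) = 0 := by
    intro g z hgz
    have hmem : g.smulRight z ∈ finiteRankInvariant Y :=
      mem_finiteRankInvariant.2 ⟨isFiniteRank_smulRight g z, hgz⟩
    have h0 := hF _ (Submodule.le_topologicalClosure _ (Submodule.mem_map_of_mem hmem))
    have h1 := hfF (evalNullSeq 𝕜 e (g.smulRight z))
    rw [h0] at h1
    refine HasSum.unique (g.hasSum (hT.2 z)) ?_
    convert h1 using 2 with n
    simp [mul_comm]
  refine hFe ((hfF e).unique ?_)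
  rw [← h T ⟨f, e, hT⟩ (fun z => ?_) (fun y hy => ?_)]
  · exact hT.hasSum_nuclearTrace hX
  · by_contra hz
    -- If `g` vanishes on `Y`, then `g ⊗ z` is admissible for every `z`.
    obtain ⟨g, hg, hgz⟩ := Submodule.exists_strongDual_of_notMem hY hz
    exact hgz (hrank g z fun y hy => by simp [hg y hy])
  · by_contra hne
    -- If `y ∈ Y`, then `g ⊗ y` is admissible for every `g`.
    obtain ⟨g, -, hg⟩ := exists_dual_vector 𝕜 (T y) (norm_ne_zero_iff.2 hne)
    rw [hrank g y fun w _ => Y.smul_mem _ hy] at hg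
    exact hne (norm_eq_zero.1 (by exact_mod_cast hg.symm))

theorem exists_finiteRankInvariant_approx [CompleteSpace X] (hX : HasAP 𝕜 X) {Y : Submodule 𝕜 X}
    (hY : IsClosed (Y : Set X))
    (h : ∀ T : X →L[𝕜] X, IsNuclear T → (∀ x : X, T x ∈ Y) → (∀ y ∈ Y, T y = 0) →
      nuclearTrace T = 0) {K : Set X} (hK : IsCompact K) {ε : ℝ} (hε : 0 < ε) :
    ∃ S ∈ finiteRankInvariant Y, ∀ x ∈ K, ‖S x - x‖ ≤ ε := by
  obtain ⟨e, he, hKe⟩ := hK.exists_null_sequence 𝕜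
  -- The weights `2⁻ᵏ` sum to 2, hence `ε / 2`.
  obtain ⟨_, ⟨S, hS, rfl⟩, hdist⟩ := Metric.mem_closure_iff.1
    (mem_closure_map_evalNullSeq hX hY h (nullSeq e he)) (ε / 2) (half_pos hε)
  refine ⟨S, hS, fun x hx => ?_⟩
  have hn : ∀ n, ‖S (e n) - e n‖ ≤ ε / 2 := by
    intro n
    rw [dist_comm, dist_eq_norm] at hdist
    exact (ZeroAtInftyContinuousMap.norm_apply_le _ n).trans hdist.le
  obtain ⟨n, hsum⟩ := hKe x hx
  have h1 := (S.hasSum hsum).sub hsum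
  have hgeo : HasSum (fun k : ℕ => (1 / 2 : ℝ) ^ k * (ε / 2)) ε := by
    simpa only [mul_div_cancel₀ ε (two_ne_zero' ℝ)] using hasSum_geometric_two.mul_right (ε / 2)
  rw [← h1.tsum_eq]
  refine tsum_of_norm_bounded hgeo fun k => ?_
  rw [map_smul, ← smul_sub, norm_smul, norm_pow, norm_div, norm_one,
    RCLike.norm_two]
  gcongr
  exact hn _

/-- The net is indexed by compact sets paired with natural numbers, with tolerance `1 / (n + 1)`;
this index type lies in the universe of `X`, as `HasPairAP` requires. -/
theorem hasPairAP_of_forall_isCompact {Y : Submodule 𝕜 X}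
    (h : ∀ K : Set X, IsCompact K → ∀ ε : ℝ, 0 < ε →
      ∃ S ∈ finiteRankInvariant Y, ∀ x ∈ K, ‖S x - x‖ ≤ ε) : HasPairAP Y := by
  choose S hS hSK using fun i : TopologicalSpace.Compacts X × ℕ =>
    h i.1 i.1.isCompact (1 / ((i.2 : ℝ) + 1)) (by positivity)
  refine ⟨TopologicalSpace.Compacts X × ℕ, inferInstance, inferInstance, inferInstance, S,
    fun i => mem_finiteRankInvariant.1 (hS i), fun K hK => Metric.tendstoUniformlyOn_iff.2 ?_⟩
  intro ε hε
  obtain ⟨m, hm⟩ := exists_nat_one_div_lt hε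
  filter_upwards [eventually_ge_atTop ((⟨K, hK⟩, m) : TopologicalSpace.Compacts X × ℕ)]
    with i hi x hx
  rw [dist_comm, dist_eq_norm]
  refine (hSK i x (hi.1 hx)).trans_lt (lt_of_le_of_lt ?_ hm)
  have : (m : ℝ) ≤ i.2 := by exact_mod_cast hi.2
  gcongr

end PairAP

theorem theorem1 {𝕜 : Type u} [RCLike 𝕜] {X : Type v} [NormedAddCommGroup X] [NormedSpace 𝕜 X]
    [CompleteSpace X] (Y : Submodule 𝕜 X) (hY : IsClosed (Y : Set X)) (hX : HasAP 𝕜 X) :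
    HasPairAP Y ↔
      ∀ T : X →L[𝕜] X, IsNuclear T → (∀ x : X, T x ∈ Y) → (∀ y ∈ Y, T y = 0) →
        nuclearTrace T = 0 :=
  ⟨fun hXY _ hT hTY hT0 => hXY.nuclearTrace_eq_zero hX hT hTY hT0, fun h =>
    hasPairAP_of_forall_isCompact fun _ hK _ hε =>
      exists_finiteRankInvariant_approx hX hY h hK hε⟩
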